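/- For an integer $m\ge 0$ let $C_m=C_m^{(5/2)}$ be the Gegenbauer polynomial of parameter $5/2$ (orthogonal on $[-1,1]$ for the weight $(1-x^2)^2$), and let $C_m=0$ for $m<0$. Let $n\ge 2$ be an integer, and set $$\delta=+\sqrt{\frac{3(n^2+3n-1)}{n(n+3)}},$$ $$R_n(x)=(n-1)(2n^2+2n-3)\,C_n(x)-(n+3)\bigl(2n^2+6n+7-2(2n+3)\delta\bigr)\,C_{n-2}(x),$$ $$S_{n+1}(x)=n\bigl(6n^2+6n-3+2(2n+1)\delta\bigr)(1+x^2)\,C_{n-1}(x)-4(2n+1)(2n^2+6n+1)\,x\,C_{n-2}(x)+(n+2)(2n^2+6n+1)(1+x^2)\,C_{n-3}(x),$$ $$A=\tfrac{2}{9}(n-1)(n+1)(n+2)(2n+1)(2n+3)(2n^2+2n-3)(2n^2+6n+1).$$ 1. $R_n$ has exactly $n$ distinct real roots $x_1,\dots,x_n$, and all of them lie in $[-1,1]$. Moreover $R_n'(x_i)\ne 0$ and $S_{n+1}(x_i)\neq 0$ for every $i$, so that the weights $$w_i=\frac{A}{R_n'(x_i)\,S_{n+1}(x_i)},\qquad i=1,\dots,n,$$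 are well defined. 2. The quadrature rule on the real line with these nodes and weights, repeated with a period of one interval, is exact for $C^1$ splines of odd degree $D=2n+1$: for every integrable (in particular, every compactly supported) $C^1$ function $f:\mathbb R\to\mathbb R$ that agrees with a polynomial of degree at most $2n+1$ on each interval $[2k-1,2k+1]$, $k\in\mathbb Z$, $$\int_{-\infty}^{\infty}f(t)\,dt=\sum_{k\in\mathbb Z}\ \sum_{i=1}^{n}w_i\,f(x_i+2k),$$ where the sum over $k$ converges unconditionally. 3. This rule is distinct from the first one-interval rule for the same splines, whose nodes in an interval are $-1$ and the roots of $C_{n-1}$: the sets of nodes on the real line of the two rules (all translates of the nodes by $2k$, $k\in\mathbb Z$) are different. 4. If $\delta$ is replaced by $-\delta$ in the definition of $R_n$, then $R_n$ has a real root outside $[-1,1]$. Hence only the positive root $\delta$ puts all nodes in $[-1,1]$. -/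

import Mathlib

open Polynomial MeasureTheory

noncomputable section

namespace SplineQuad

/-- The Gegenbauer (ultraspherical) polynomials with parameter `lam`, by the three-term recurrence
`m C_m = 2 (m + lam - 1) x C_{m-1} - (m + 2 lam - 2) C_{m-2}` with `C_0 = 1`, `C_1 = 2 lam x`. -/
def gegenbauer (lam : ℝ) : ℕ → ℝ[X]
  | 0 => 1
  | 1 => C (2 * lam) * X
  | (m + 2) =>
      C (1 / ((m : ℝ) + 2)) *
        (C (2 * ((m : ℝ) + 1 + lam)) * X * gegenbauer lam (m + 1)
          - C ((m : ℝ) + 2 * lam) * gegenbauer lam m)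

/-- The Gegenbauer polynomials of parameter `5 / 2`, with an integer index and the usual convention
that they vanish for a negative index. -/
def geg : ℤ → ℝ[X]
  | Int.ofNat m => gegenbauer (5 / 2) m
  | Int.negSucc _ => 0

/-- The positive root `δ`. -/
def delta (n : ℕ) : ℝ :=
  Real.sqrt (3 * ((n : ℝ) ^ 2 + 3 * n - 1) / (n * ((n : ℝ) + 3)))

/-- The polynomial `R_n`, for a given choice `d` of the square root (`d = δ` or `d = -δ`). -/
def polyR (n : ℕ) (d : ℝ) : ℝ[X] :=
  C (((n : ℝ) - 1) * (2 * (n : ℝ) ^ 2 + 2 * n - 3)) * geg n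
    - C (((n : ℝ) + 3) * (2 * (n : ℝ) ^ 2 + 6 * n + 7 - 2 * (2 * n + 3) * d)) * geg ((n : ℤ) - 2)

/-- The polynomial `S_{n+1}`, for a given choice `d` of the square root. -/
def polyS (n : ℕ) (d : ℝ) : ℝ[X] :=
  C ((n : ℝ) * (6 * (n : ℝ) ^ 2 + 6 * n - 3 + 2 * (2 * n + 1) * d)) * (1 + X ^ 2)
      * geg ((n : ℤ) - 1)
    - C (4 * (2 * (n : ℝ) + 1) * (2 * (n : ℝ) ^ 2 + 6 * n + 1)) * X * geg ((n : ℤ) - 2)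
    + C (((n : ℝ) + 2) * (2 * (n : ℝ) ^ 2 + 6 * n + 1)) * (1 + X ^ 2) * geg ((n : ℤ) - 3)

/-- The constant `A` of the weights. -/
def constA (n : ℕ) : ℝ :=
  2 * ((n : ℝ) - 1) * ((n : ℝ) + 1) * ((n : ℝ) + 2) * (2 * (n : ℝ) + 1) * (2 * (n : ℝ) + 3)
    * (2 * (n : ℝ) ^ 2 + 2 * n - 3) * (2 * (n : ℝ) ^ 2 + 6 * n + 1) / 9

/-- The nodes: the set of real roots of `R_n` (for the positive root `δ`). -/
def nodes (n : ℕ) : Finset ℝ := (polyR n (delta n)).roots.toFinset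

/-- The weight `A / (R_n'(x) S_{n+1}(x))` of a node `x`. -/
def weight (n : ℕ) (x : ℝ) : ℝ :=
  constA n / ((derivative (polyR n (delta n))).eval x * (polyS n (delta n)).eval x)

/-- The nodes of the first quadrature rule for `C^1` splines of degree `2 n + 1`:
the end point `-1` and the roots of `C_{n-1}`. -/
def firstNodes (n : ℕ) : Finset ℝ := insert (-1) (geg ((n : ℤ) - 1)).roots.toFinset

/-- All nodes on the real line of the rule of period one interval (of length 2) that has the
nodes `N` in the interval `[-1, 1]`. -/
def periodicNodes (N : Finset ℝ) : Set ℝ := {y | ∃ k : ℤ, ∃ x ∈ N, y = x + 2 * k}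

/-- `f` is a `C^1` spline of degree at most `D` on the real line, with the uniform partition into
the intervals `[2 k - 1, 2 k + 1]`, `k ∈ ℤ`. -/
def IsC1Spline (D : ℕ) (f : ℝ → ℝ) : Prop :=
  ContDiff ℝ 1 f ∧ ∀ k : ℤ, ∃ p : ℝ[X], p.natDegree ≤ D ∧
    ∀ x ∈ Set.Icc (2 * (k : ℝ) - 1) (2 * (k : ℝ) + 1), f x = p.eval x

/-- The rule with period one interval, nodes `N` and weights `w`, is exact for the `C^1` splines of
degree at most `D` on the real line: for each such spline that is integrable (in particular for
each one of compact support), the quadrature sum converges to the integral. -/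
def IsExactC1 (D : ℕ) (N : Finset ℝ) (w : ℝ → ℝ) : Prop :=
  ∀ f : ℝ → ℝ, IsC1Spline D f → Integrable f →
    HasSum (fun k : ℤ => ∑ x ∈ N, w x * f (x + 2 * k)) (∫ t, f t)

end SplineQuad

end

open Polynomial MeasureTheory

namespace SplineQuad

/-! ### Gegenbauer polynomials: contiguous relations and derivatives. -/

section Gegenbauer

/-! For a C¹ spline the derivatives at the knots agree from both sides, so sums of `p'(1) - p'(-1)`
over the intervals telescope to zero. It therefore suffices that the rule on `[-1, 1]` reproduces `L
p = ∫ p - c (p'(1) - p'(-1))` for some constant `c`, up to degree `2 n + 1` (`sum_weight_mul_eval`).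
This is Gauss quadrature for `L`, with two degrees more than `n` nodes usually give.

The extra degrees come from `c` and `δ`. Since `P_m'' = 3 C_{m-2}` for Legendre `P_m`, one has `3
R_n = G''` with `G` a combination of `P_{n+2}` and `P_n`. Two integrations by parts reduce `L (R_n
q)`, for `deg q ≤ n + 1`, to boundary terms. These vanish when `G = -3 c R_n` and `G' = 3 c R_n'` at
`±1`: the first equation defines `c`, the second is a quadratic satisfied by `δ`
(`functional_polyR_mul`).

The same method gives `L (S_{n+1} q) = A` for every `q` of degree at most `n - 1` whose coefficient
of `x^(n-1)` is the leading coefficient of `R_n`. Taking `q = R_n / (x - x_i)` and replacing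
`S_{n+1}` by its value at `x_i` modulo `x - x_i` yields the weights, and `A ≠ 0` gives `S_{n+1}(x_i)
≠ 0` (`functional_divByMonic_mul`).

`L` is not used to locate the roots. Instead `R_n` is tested against the weight `(1 - x²)²`: fewer
than `n` sign changes would mean at most `n - 2` by parity, and then the integral has the wrong sign
(`exists_finset_roots`).

Convergence follows because `p ↦ p'(-1)` is bounded by the L¹ norm on polynomials of bounded degree.
-/

theorem gegenbauer_recurrence (lam : ℝ) (m : ℕ) :
    ((m : ℝ[X]) + 2) * gegenbauer lam (m + 2) =
      2 * ((m : ℝ[X]) + 1 + C lam) * X * gegenbauer lam (m + 1)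
        - ((m : ℝ[X]) + 2 * C lam) * gegenbauer lam m := by
  have h : ((m : ℝ) + 2) * (1 / ((m : ℝ) + 2)) = 1 := by
    have : (m : ℝ) + 2 ≠ 0 := by positivity
    field_simp
  have h' : ((m : ℝ[X]) + 2) = C ((m : ℝ) + 2) := by simp [map_ofNat]
  rw [gegenbauer, ← mul_assoc, h', ← C_mul, h, C_1, one_mul]
  simp [map_ofNat]

theorem natCast_add_two_ne_zero (k : ℕ) : ((k : ℝ[X]) + 2) ≠ 0 := by
  exact_mod_cast (Nat.succ_ne_zero (k + 1))

/-- The recurrence at parameter `lam + 1` eliminates the polynomial of index `k`, so the first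
contiguous relation implies the second one at the next index. The induction below then only has to
establish the first. -/
theorem gegenbauer_contiguous_of_backward (lam : ℝ) (k : ℕ)
    (hk : ((k : ℝ[X]) + 2) * gegenbauer lam (k + 2) =
      2 * C lam * (X * gegenbauer (lam + 1) (k + 1) - gegenbauer (lam + 1) k)) :
    ((k : ℝ[X]) + 2 + 2 * C lam) * gegenbauer lam (k + 2) =
      2 * C lam * (gegenbauer (lam + 1) (k + 2) - X * gegenbauer (lam + 1) (k + 1)) := by
  apply mul_left_cancel₀ (natCast_add_two_ne_zero k)
  have h1 := gegenbauer_recurrence (lam + 1) k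
  simp only [map_add, map_one] at h1
  linear_combination ((k : ℝ[X]) + 2 + 2 * C lam) * hk - 2 * C lam * h1

/-- The two relations between the Gegenbauer polynomials of parameters `lam` and `lam + 1`. -/
theorem gegenbauer_contiguous (lam : ℝ) (m : ℕ) :
    (((m : ℝ[X]) + 2) * gegenbauer lam (m + 2) =
      2 * C lam * (X * gegenbauer (lam + 1) (m + 1) - gegenbauer (lam + 1) m)) ∧
    (((m : ℝ[X]) + 1 + 2 * C lam) * gegenbauer lam (m + 1) =
      2 * C lam * (gegenbauer (lam + 1) (m + 1) - X * gegenbauer (lam + 1) m)) := by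
  induction m with
  | zero =>
    have h2 := gegenbauer_recurrence lam 0
    simp only [gegenbauer, map_add, map_mul, map_ofNat, Nat.cast_zero, map_one, zero_add] at h2 ⊢
    exact ⟨by linear_combination h2, by ring⟩
  | succ m ih =>
    have h2 := gegenbauer_recurrence lam (m + 1)
    have h3 := gegenbauer_contiguous_of_backward lam m ih.1
    push_cast at h2 ⊢
    refine ⟨?_, by linear_combination h3⟩
    -- The factor `2 (m + 2 + lam)` of the recurrence splits as `(m + 2) + (m + 2 + 2 lam)`, the
    -- factors in `ih.1` and `h3`.
    linear_combination h2 + X * ih.1 + X * h3 - ih.2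

/-- In the sum of the two contiguous relations for index `m + 2` the terms with `X` cancel. -/
theorem gegenbauer_add_two (lam : ℝ) (m : ℕ) :
    ((m : ℝ[X]) + 2 + C lam) * gegenbauer lam (m + 2) =
      C lam * (gegenbauer (lam + 1) (m + 2) - gegenbauer (lam + 1) m) := by
  have h := (gegenbauer_contiguous lam m).1
  have h' := gegenbauer_contiguous_of_backward lam m h
  apply mul_left_cancel₀ (two_ne_zero : (2 : ℝ[X]) ≠ 0)
  linear_combination h + h'

theorem derivative_gegenbauer (lam : ℝ) (m : ℕ) :
    derivative (gegenbauer lam (m + 1)) = 2 * C lam * gegenbauer (lam + 1) m := by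
  induction m using Nat.twoStepInduction with
  | zero => simp [gegenbauer, map_ofNat]
  | one =>
    have h := congrArg derivative (gegenbauer_recurrence lam 0)
    apply mul_left_cancel₀ (two_ne_zero : (2 : ℝ[X]) ≠ 0)
    rw [show gegenbauer lam (0 + 1) = 2 * C lam * X by simp [gegenbauer, map_ofNat]] at h
    rw [show gegenbauer (lam + 1) 1 = 2 * (C lam + 1) * X by simp [gegenbauer, map_ofNat]]
    simp [show derivative (gegenbauer lam 0) = 0 by simp [gegenbauer]] at h
    linear_combination h
  | more m ih0 ih1 =>
    have h := congrArg derivative (gegenbauer_recurrence lam (m + 1))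
    have h1 := (gegenbauer_contiguous lam m).1
    have h2 := gegenbauer_contiguous_of_backward lam m h1
    have h3 := gegenbauer_recurrence (lam + 1) m
    apply mul_left_cancel₀ (natCast_add_two_ne_zero (m + 1))
    rw [show m + 1 + 2 = m + 2 + 1 from rfl] at h
    simp only [derivative_sub, derivative_mul, derivative_natCast, derivative_ofNat,
      derivative_one, derivative_C, derivative_X, ih0, ih1, map_add, map_one, Nat.cast_add,
      Nat.cast_one] at h h3 ⊢
    linear_combination h + h1 + h2 - 2 * C lam * h3

end Gegenbauer

/-! ### Legendre polynomials: endpoint values and leading coefficients. -/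

section Legendre

/-- The Legendre polynomials. -/
noncomputable abbrev legendre (m : ℕ) : ℝ[X] := gegenbauer (1 / 2) m

theorem C_half : 2 * (C (1 / 2 : ℝ) : ℝ[X]) = 1 := by
  rw [← map_ofNat C 2, ← C_mul]; norm_num

theorem legendre_recurrence (m : ℕ) :
    ((m : ℝ[X]) + 2) * legendre (m + 2) =
      (2 * (m : ℝ[X]) + 3) * X * legendre (m + 1) - ((m : ℝ[X]) + 1) * legendre m := by
  linear_combination gegenbauer_recurrence (1 / 2) m
    + (X * legendre (m + 1) - legendre m) * C_half

theorem legendre_zero : legendre 0 = 1 := rfl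

theorem legendre_one : legendre 1 = X := by
  simp [legendre, gegenbauer]

theorem legendre_eq_derivative (m : ℕ) :
    (2 * (m : ℝ[X]) + 3) * legendre (m + 1) =
      derivative (legendre (m + 2)) - derivative (legendre m) := by
  cases m with
  | zero =>
    have h := congrArg derivative (legendre_recurrence 0)
    simp [legendre_one, legendre_zero] at h ⊢
    apply mul_left_cancel₀ (two_ne_zero : (2 : ℝ[X]) ≠ 0)
    linear_combination -h
  | succ k =>
    have h := gegenbauer_add_two (1 / 2) k
    rw [legendre, legendre, legendre, derivative_gegenbauer, derivative_gegenbauer]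
    push_cast
    linear_combination 2 * h - legendre (k + 2) * C_half

/-- Each derivative raises the parameter by one, from `1/2` to `5/2`; the factor is `(2 · 1/2)(2 ·
3/2) = 3`. -/
theorem iterate_derivative_legendre (m : ℕ) :
    derivative (derivative (legendre (m + 2))) = 3 * gegenbauer (5 / 2) m := by
  rw [legendre, derivative_gegenbauer, C_half, one_mul, derivative_gegenbauer,
    show (2 : ℝ[X]) * C (1 / 2 + 1) = 3 by
      rw [← map_ofNat C 2, ← map_ofNat C 3, ← C_mul]; norm_num]
  norm_num

/-- The zero convention for negative indices matches `P_0'' = P_1'' = 0`, so small `n` needs no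
separate treatment. -/
theorem geg_sub_two (m : ℕ) :
    3 * geg ((m : ℤ) - 2) = derivative (derivative (legendre m)) := by
  match m with
  | 0 => simp [show geg (-2) = 0 from rfl, legendre_zero]
  | 1 => simp [show geg (-1) = 0 from rfl, legendre_one]
  | k + 2 =>
    rw [iterate_derivative_legendre, show ((k + 2 : ℕ) : ℤ) - 2 = Int.ofNat k by
      push_cast; simp]
    rfl

/-- The hypothesis `e * e = 1` treats both endpoints `±1` at once, here and in the derivative
formulas obtained by differentiating the recurrence. -/
theorem eval_legendre {e : ℝ} (he : e * e = 1) (m : ℕ) : (legendre m).eval e = e ^ m := by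
  induction m using Nat.twoStepInduction with
  | zero => simp [legendre_zero]
  | one => simp [legendre_one]
  | more m ih0 ih1 =>
    have h := congrArg (eval e) (legendre_recurrence m)
    simp [ih0, ih1] at h
    have h0 : (m : ℝ) + 2 ≠ 0 := by positivity
    apply mul_left_cancel₀ h0
    linear_combination h + (m + 1) * e ^ m * he

theorem eval_derivative_legendre {e : ℝ} (he : e * e = 1) (m : ℕ) :
    (derivative (legendre m)).eval e = e * e ^ m * (m * (m + 1) / 2) := by
  induction m using Nat.twoStepInduction with
  | zero => simp [legendre_zero]
  | one => simp [legendre_one, he]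
  | more m ih0 ih1 =>
    have h := congrArg (fun p => (derivative p).eval e) (legendre_recurrence m)
    simp [ih0, ih1, eval_legendre he] at h
    have h0 : (m : ℝ) + 2 ≠ 0 := by positivity
    apply mul_left_cancel₀ h0
    push_cast
    linear_combination h + ((m + 1) * (m * (m + 1) / 2) - (2 * m + 3)) * e ^ m * e * he

theorem eval_derivative2_legendre {e : ℝ} (he : e * e = 1) (m : ℕ) :
    (derivative (derivative (legendre m))).eval e =
      e ^ m * ((m - 1) * m * (m + 1) * (m + 2) / 8) := by
  induction m using Nat.twoStepInduction with
  | zero => simp [legendre_zero]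
  | one => simp [legendre_one]
  | more m ih0 ih1 =>
    have h := congrArg (fun p => (derivative (derivative p)).eval e) (legendre_recurrence m)
    simp [ih0, ih1, eval_derivative_legendre he] at h
    have h0 : (m : ℝ) + 2 ≠ 0 := by positivity
    apply mul_left_cancel₀ h0
    push_cast
    linear_combination h + (m + 1) * ((m - 1) * m * (m + 1) * (m + 2) / 8) * e ^ m * he

theorem eval_derivative3_legendre {e : ℝ} (he : e * e = 1) (m : ℕ) :
    (derivative (derivative (derivative (legendre m)))).eval e =
      e * e ^ m * ((m - 2) * (m - 1) * m * (m + 1) * (m + 2) * (m + 3) / 48) := by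
  induction m using Nat.twoStepInduction with
  | zero => simp [legendre_zero]
  | one => simp [legendre_one]
  | more m ih0 ih1 =>
    have h := congrArg (fun p => (derivative (derivative (derivative p))).eval e)
      (legendre_recurrence m)
    simp [ih0, ih1, eval_derivative2_legendre he] at h
    have h0 : (m : ℝ) + 2 ≠ 0 := by positivity
    apply mul_left_cancel₀ h0
    push_cast
    linear_combination h + ((m + 1) * ((m - 2) * (m - 1) * m * (m + 1) * (m + 2) * (m + 3) / 48)
      - 3 * (2 * m + 3) * (m * (m + 1) * (m + 2) * (m + 3) / 8)) * e ^ m * e * he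

theorem natDegree_legendre_le (m : ℕ) : (legendre m).natDegree ≤ m := by
  induction m using Nat.twoStepInduction with
  | zero => simp [legendre_zero]
  | one => simp [legendre_one]
  | more m ih0 ih1 =>
    have h := legendre_recurrence m
    have h0 : (m : ℝ) + 2 ≠ 0 := by positivity
    rw [show (m : ℝ[X]) + 2 = C ((m : ℝ) + 2) by simp [map_ofNat],
      show 2 * (m : ℝ[X]) + 3 = C (2 * (m : ℝ) + 3) by simp [map_ofNat],
      show (m : ℝ[X]) + 1 = C ((m : ℝ) + 1) by simp, mul_assoc] at h
    rw [← natDegree_C_mul h0, h]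
    refine (natDegree_sub_le _ _).trans (max_le ?_ ?_)
    · refine (natDegree_C_mul_le _ _).trans (natDegree_mul_le.trans ?_)
      rw [natDegree_X]; omega
    · exact (natDegree_C_mul_le _ _).trans (by omega)

theorem coeff_legendre_succ (m : ℕ) :
    ((m : ℝ) + 1) * (legendre (m + 1)).coeff (m + 1) = (2 * m + 1) * (legendre m).coeff m := by
  cases m with
  | zero => simp [legendre_one, legendre_zero]
  | succ k =>
    have h := congrArg (fun p => p.coeff (k + 2)) (legendre_recurrence k)
    rw [show (k : ℝ[X]) + 2 = C ((k : ℝ) + 2) by simp [map_ofNat],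
      show 2 * (k : ℝ[X]) + 3 = C (2 * (k : ℝ) + 3) by simp [map_ofNat],
      show (k : ℝ[X]) + 1 = C ((k : ℝ) + 1) by simp] at h
    simp only [coeff_sub, mul_assoc, coeff_C_mul, coeff_X_mul] at h
    rw [coeff_eq_zero_of_natDegree_lt (lt_of_le_of_lt (natDegree_legendre_le k) (by omega))] at h
    push_cast
    linear_combination h

theorem coeff_legendre_pos (m : ℕ) : 0 < (legendre m).coeff m := by
  induction m with
  | zero => simp [legendre_zero]
  | succ m ih =>
    have h := coeff_legendre_succ m
    have h1 : 0 < (2 * (m : ℝ) + 1) * (legendre m).coeff m := by positivity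
    rw [← h] at h1
    exact pos_of_mul_pos_right h1 (by positivity)

end Legendre

/-! ### Integration over `[-1, 1]` and Legendre orthogonality. -/

section Integral

/-- The integral of a polynomial over `[-1, 1]`. -/
noncomputable def integ : ℝ[X] →ₗ[ℝ] ℝ where
  toFun p := ∫ x in (-1 : ℝ)..1, p.eval x
  map_add' p q := by
    simp only [eval_add]
    exact intervalIntegral.integral_add (p.continuous.intervalIntegrable _ _)
      (q.continuous.intervalIntegrable _ _)
  map_smul' a p := by
    simp [intervalIntegral.integral_const_mul]

theorem integ_apply (p : ℝ[X]) : integ p = ∫ x in (-1 : ℝ)..1, p.eval x := rfl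

theorem integ_C_mul (a : ℝ) (p : ℝ[X]) : integ (C a * p) = a * integ p := by
  rw [← smul_eq_C_mul, map_smul, smul_eq_mul]

theorem integ_derivative (p : ℝ[X]) : integ (derivative p) = p.eval 1 - p.eval (-1) :=
  intervalIntegral.integral_eq_sub_of_hasDerivAt (fun x _ => p.hasDerivAt x)
    ((derivative p).continuous.intervalIntegrable _ _)

theorem integ_derivative2_mul (p q : ℝ[X]) :
    integ (derivative (derivative p) * q) =
      (derivative p * q - p * derivative q).eval 1
        - (derivative p * q - p * derivative q).eval (-1)
        + integ (p * derivative (derivative q)) := by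
  rw [← integ_derivative, ← map_add]
  congr 1
  simp only [derivative_sub, derivative_mul]
  ring

theorem integ_legendre_succ (m : ℕ) : integ (legendre (m + 1)) = 0 := by
  have h := congrArg integ (legendre_eq_derivative m)
  rw [show 2 * (m : ℝ[X]) + 3 = C (2 * (m : ℝ) + 3) by simp [map_ofNat], integ_C_mul, map_sub,
    integ_derivative, integ_derivative, eval_legendre (by norm_num), eval_legendre (by norm_num),
    eval_legendre (by norm_num), eval_legendre (by norm_num)] at h
  have h0 : 2 * (m : ℝ) + 3 ≠ 0 := by positivity
  apply mul_left_cancel₀ h0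
  rw [h]
  ring

/-- The three-term recurrence trades a power of `X` for a shift of the index; orthogonality follows
by induction on the power. -/
theorem integ_X_pow_succ_mul_legendre (k m : ℕ) :
    (2 * (m : ℝ) + 3) * integ (X ^ (k + 1) * legendre (m + 1)) =
      (m + 2) * integ (X ^ k * legendre (m + 2)) + (m + 1) * integ (X ^ k * legendre m) := by
  rw [← integ_C_mul, ← integ_C_mul, ← integ_C_mul, ← map_add]
  congr 1
  have h := legendre_recurrence m
  simp only [map_add, map_mul, map_ofNat, map_natCast, map_one]
  linear_combination -X ^ k * h

theorem integ_X_pow_mul_legendre_of_lt {k m : ℕ} (h : k < m) :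
    integ (X ^ k * legendre m) = 0 := by
  induction k generalizing m with
  | zero =>
    obtain ⟨m, rfl⟩ := Nat.exists_eq_succ_of_ne_zero h.ne'
    simpa using integ_legendre_succ m
  | succ k ih =>
    obtain ⟨m, rfl⟩ := Nat.exists_eq_succ_of_ne_zero (by omega : m ≠ 0)
    have h1 := integ_X_pow_succ_mul_legendre k m
    rw [ih (by omega), ih (by omega)] at h1
    have h0 : 2 * (m : ℝ) + 3 ≠ 0 := by positivity
    apply mul_left_cancel₀ h0
    rw [h1]; simp

/-- Integration of a Legendre polynomial against a polynomial of at most the same degree only sees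
the top coefficient. -/
theorem integ_legendre_mul {m : ℕ} {q : ℝ[X]} (hq : q.natDegree ≤ m) :
    integ (legendre m * q) = q.coeff m * integ (X ^ m * legendre m) := by
  conv_lhs => rw [q.as_sum_range_C_mul_X_pow' (Nat.lt_succ_of_le hq)]
  rw [Finset.mul_sum, map_sum, Finset.sum_range_succ, Finset.sum_eq_zero, zero_add,
    mul_left_comm, integ_C_mul, mul_comm (legendre m)]
  intro k hk
  rw [mul_left_comm, integ_C_mul, mul_comm (legendre m),
    integ_X_pow_mul_legendre_of_lt (Finset.mem_range.mp hk), mul_zero]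

theorem integ_legendre_mul_of_lt {m : ℕ} {q : ℝ[X]} (hq : q.natDegree < m) :
    integ (legendre m * q) = 0 := by
  rw [integ_legendre_mul hq.le, coeff_eq_zero_of_natDegree_lt hq, zero_mul]

/-- This is `‖P_m‖² = 2 / (2 m + 1)` in disguise. Keeping the product avoids closed forms for either
factor. -/
theorem integ_X_pow_mul_legendre_mul_coeff (m : ℕ) :
    (2 * (m : ℝ) + 1) * (integ (X ^ m * legendre m) * (legendre m).coeff m) = 2 := by
  induction m with
  | zero =>
    simp [legendre_zero, integ_apply]
    norm_num
  | succ m ih =>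
    have h := integ_X_pow_succ_mul_legendre m m
    rw [integ_X_pow_mul_legendre_of_lt (by omega : m < m + 2)] at h
    have h1 := coeff_legendre_succ m
    have h0 : (m : ℝ) + 1 ≠ 0 := by positivity
    apply mul_left_cancel₀ h0
    push_cast
    linear_combination ((m : ℝ) + 1) * (legendre (m + 1)).coeff (m + 1) * h +
      ((m : ℝ) + 1) * integ (X ^ m * legendre m) * h1 + ((m : ℝ) + 1) * ih

theorem integ_X_pow_mul_legendre_pos (m : ℕ) : 0 < integ (X ^ m * legendre m) := by
  have h := integ_X_pow_mul_legendre_mul_coeff m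
  have h1 := coeff_legendre_pos m
  by_contra! hneg
  have : (2 * (m : ℝ) + 1) * (integ (X ^ m * legendre m) * (legendre m).coeff m) ≤ 0 :=
    mul_nonpos_of_nonneg_of_nonpos (by positivity) (mul_nonpos_of_nonpos_of_nonneg hneg h1.le)
  linarith

/-- A linear functional on polynomials of bounded degree is integration against a polynomial. -/
theorem exists_integ_mul_eq (φ : ℝ[X] →ₗ[ℝ] ℝ) (D : ℕ) :
    ∃ g : ℝ[X], ∀ q : ℝ[X], q.natDegree ≤ D → φ q = integ (q * g) := by
  induction D with
  | zero =>
    refine ⟨C (φ 1 / 2), fun q hq => ?_⟩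
    rw [eq_C_of_natDegree_le_zero hq, ← mul_one (C (q.coeff 0)), ← smul_eq_C_mul, map_smul,
      smul_mul_assoc, map_smul, one_mul, integ_apply]
    simp
    ring_nf
    tauto
  | succ D ih =>
    obtain ⟨g, hg⟩ := ih
    -- Adding a multiple of `P_{D+1}` does not disturb degrees up to `D`; `t` is fixed by the value
    -- on `X ^ (D + 1)`.
    set t : ℝ := (φ (X ^ (D + 1)) - integ (X ^ (D + 1) * g))
      / integ (X ^ (D + 1) * legendre (D + 1)) with ht
    have hI := (integ_X_pow_mul_legendre_pos (D + 1)).ne'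
    refine ⟨g + C t * legendre (D + 1), fun q hq => ?_⟩
    have hq1 : q = C (q.coeff (D + 1)) * X ^ (D + 1) + (q - C (q.coeff (D + 1)) * X ^ (D + 1)) := by
      ring
    have hr : (q - C (q.coeff (D + 1)) * X ^ (D + 1)).natDegree ≤ D := by
      rw [natDegree_le_iff_coeff_eq_zero]
      intro N hN
      rw [coeff_sub, coeff_C_mul, coeff_X_pow]
      split_ifs with h
      · subst h; simp
      · rw [coeff_eq_zero_of_natDegree_lt (by omega)]; simp
    set r := q - C (q.coeff (D + 1)) * X ^ (D + 1) with hr'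
    have e1 : q * (g + C t * legendre (D + 1)) = C (q.coeff (D + 1)) *
        (X ^ (D + 1) * g + C t * (X ^ (D + 1) * legendre (D + 1))) + r * g
        + C t * (legendre (D + 1) * r) := by
      linear_combination (g + C t * legendre (D + 1)) * hq1
    rw [e1, map_add, map_add, integ_C_mul, map_add, integ_C_mul, integ_C_mul,
      integ_legendre_mul_of_lt (Nat.lt_succ_of_le hr), ← hg r hr]
    conv_lhs => rw [hq1, map_add, ← smul_eq_C_mul, map_smul, smul_eq_mul]
    rw [ht]
    field_simp
    ring

end Integral

end SplineQuad

namespace SplineQuad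

/-! ### The quadratic equation and bounds for `δ`. -/

section Delta

theorem delta_sq {n : ℕ} (hn : 2 ≤ n) :
    (n : ℝ) * (n + 3) * delta n ^ 2 = 3 * ((n : ℝ) ^ 2 + 3 * n - 1) := by
  have h2 : (2 : ℝ) ≤ n := by exact_mod_cast hn
  rw [delta, Real.sq_sqrt (div_nonneg (by nlinarith) (by positivity))]
  have : (n : ℝ) ≠ 0 := by positivity
  have : (n : ℝ) + 3 ≠ 0 := by positivity
  field_simp

theorem one_lt_delta {n : ℕ} (hn : 2 ≤ n) : 1 < delta n := by
  have h2 : (2 : ℝ) ≤ n := by exact_mod_cast hn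
  rw [delta]
  apply Real.lt_sqrt_of_sq_lt
  rw [lt_div_iff₀ (by positivity)]
  nlinarith

/-- Here `δ² = 3 - 3 / (n (n + 3)) < 3 < (7/4)²`. The bound is sharp enough to make `coefB` positive
already at `n = 2`. -/
theorem delta_lt {n : ℕ} (hn : 2 ≤ n) : delta n < 7 / 4 := by
  have h2 : (2 : ℝ) ≤ n := by exact_mod_cast hn
  rw [delta, Real.sqrt_lt' (by norm_num), div_lt_iff₀ (by positivity)]
  nlinarith

end Delta

/-! ### The polynomial `R_n`: second antiderivative, endpoint values, degree. -/

section PolyR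

/-- The coefficient of `C_n` in `R_n`. -/
noncomputable def coefA (n : ℕ) : ℝ := ((n : ℝ) - 1) * (2 * (n : ℝ) ^ 2 + 2 * n - 3)

/-- Minus the coefficient of `C_{n-2}` in `R_n`. -/
noncomputable def coefB (n : ℕ) (d : ℝ) : ℝ :=
  ((n : ℝ) + 3) * (2 * (n : ℝ) ^ 2 + 6 * n + 7 - 2 * (2 * n + 3) * d)

/-- A second antiderivative of `3 R_n`. -/
noncomputable def primR (n : ℕ) (d : ℝ) : ℝ[X] :=
  C (coefA n) * legendre (n + 2) - C (coefB n d) * legendre n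

theorem derivative2_primR (n : ℕ) (d : ℝ) :
    derivative (derivative (primR n d)) = 3 * polyR n d := by
  have h1 := geg_sub_two (n + 2)
  have h2 := geg_sub_two n
  rw [show ((n + 2 : ℕ) : ℤ) - 2 = n by push_cast; ring] at h1
  simp only [primR, polyR, coefA, coefB, derivative_sub, derivative_C_mul, ← h1, ← h2]
  ring

theorem coefA_pos {n : ℕ} (hn : 2 ≤ n) : 0 < coefA n := by
  have h2 : (2 : ℝ) ≤ n := by exact_mod_cast hn
  exact mul_pos (by linarith) (by nlinarith)

theorem coefB_pos {n : ℕ} (hn : 2 ≤ n) : 0 < coefB n (delta n) := by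
  have h2 : (2 : ℝ) ≤ n := by exact_mod_cast hn
  have := delta_lt hn
  exact mul_pos (by linarith) (by nlinarith)

/-- The value of `R_n` at `1`. -/
noncomputable def valR (n : ℕ) (d : ℝ) : ℝ :=
  ((n : ℝ) - 1) * (n + 1) * (n + 2) * (n + 3) * (2 * n + 3) * (n - 2 + n * d) / 12

theorem eval_primR {e : ℝ} (he : e * e = 1) (n : ℕ) (d : ℝ) :
    (primR n d).eval e = e ^ n * (coefA n - coefB n d) := by
  simp only [primR, eval_sub, eval_mul, eval_C, eval_legendre he, pow_succ]
  linear_combination coefA n * e ^ n * he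

theorem eval_derivative_primR {e : ℝ} (he : e * e = 1) (n : ℕ) (d : ℝ) :
    (derivative (primR n d)).eval e =
      e * e ^ n * (coefA n * ((n + 2) * (n + 3) / 2) - coefB n d * (n * (n + 1) / 2)) := by
  simp only [primR, derivative_sub, derivative_C_mul, eval_sub, eval_mul, eval_C,
    eval_derivative_legendre he, pow_succ]
  push_cast
  linear_combination e * e ^ n * (coefA n * ((n + 2) * (n + 3) / 2)) * he

theorem eval_polyR {e : ℝ} (he : e * e = 1) (n : ℕ) (d : ℝ) :
    (polyR n d).eval e = e ^ n * valR n d := by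
  have h := congrArg (eval e) (derivative2_primR n d)
  simp only [primR, derivative_sub, derivative_C_mul, eval_sub, eval_mul, eval_C, eval_ofNat,
    eval_derivative2_legendre he, pow_succ] at h
  push_cast at h
  simp only [valR, coefA, coefB] at h ⊢
  linear_combination (-1 / 3) * h + e ^ n * (((n : ℝ) - 1) * (2 * (n : ℝ) ^ 2 + 2 * n - 3)) *
    (((n + 1) * (n + 2) * (n + 3) * (n + 4) / 24)) * he

theorem eval_derivative_polyR {e : ℝ} (he : e * e = 1) (n : ℕ) (d : ℝ) :
    (derivative (polyR n d)).eval e =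
      e * e ^ n * (coefA n * (n * (n + 1) * (n + 2) * (n + 3) * (n + 4) * (n + 5)) -
        coefB n d * ((n - 2) * (n - 1) * n * (n + 1) * (n + 2) * (n + 3))) / 144 := by
  have h := congrArg (fun p => (derivative p).eval e) (derivative2_primR n d)
  rw [← map_ofNat C 3] at h
  simp only [primR, derivative_sub, derivative_C_mul, eval_sub, eval_mul, eval_C,
    eval_derivative3_legendre he, pow_succ] at h
  push_cast at h
  linear_combination (-1 / 3) * h + e * e ^ n * coefA n *
    ((n * (n + 1) * (n + 2) * (n + 3) * (n + 4) * (n + 5)) / 144) * he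

theorem valR_pos {n : ℕ} (hn : 2 ≤ n) : 0 < valR n (delta n) := by
  have h2 : (2 : ℝ) ≤ n := by exact_mod_cast hn
  have h1 : (0 : ℝ) < n - 1 := by linarith
  have h3 : (0 : ℝ) < n - 2 + n * delta n := by nlinarith [one_lt_delta hn]
  unfold valR
  positivity

/-- The only factor depending on the square root becomes `n - 2 - n δ`, negative because `δ > 1`.
With a positive leading coefficient this forces a root beyond `1`. -/
theorem valR_neg {n : ℕ} (hn : 2 ≤ n) : valR n (-delta n) < 0 := by
  have h2 : (2 : ℝ) ≤ n := by exact_mod_cast hn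
  have h1 : (0 : ℝ) < n - 1 := by linarith
  have h3 : n - 2 + n * (-delta n) < 0 := by nlinarith [one_lt_delta hn]
  unfold valR
  exact div_neg_of_neg_of_pos (mul_neg_of_pos_of_neg (by positivity) h3) (by norm_num)

theorem natDegree_primR_le (n : ℕ) (d : ℝ) : (primR n d).natDegree ≤ n + 2 :=
  (natDegree_sub_le _ _).trans (max_le
    ((natDegree_C_mul_le _ _).trans (natDegree_legendre_le _))
    ((natDegree_C_mul_le _ _).trans ((natDegree_legendre_le _).trans (by omega))))

theorem natDegree_polyR_le (n : ℕ) (d : ℝ) : (polyR n d).natDegree ≤ n := by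
  have h : (C (3 : ℝ) * polyR n d).natDegree ≤ n := by
    rw [map_ofNat, ← derivative2_primR]
    refine (natDegree_derivative_le _).trans ?_
    have := natDegree_derivative_le (primR n d)
    have := natDegree_primR_le n d
    omega
  rwa [natDegree_C_mul (by norm_num)] at h

theorem coeff_polyR (n : ℕ) (d : ℝ) :
    3 * (polyR n d).coeff n = coefA n * ((n + 1) * (n + 2)) * (legendre (n + 2)).coeff (n + 2) := by
  have h := congrArg (fun p => p.coeff n) (derivative2_primR n d)
  have h0 : (legendre n).coeff (n + 2) = 0 :=
    coeff_eq_zero_of_natDegree_lt (lt_of_le_of_lt (natDegree_legendre_le n) (by omega))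
  simp only [coeff_derivative] at h
  rw [← map_ofNat C 3, coeff_C_mul, primR, coeff_sub, coeff_C_mul, coeff_C_mul, h0] at h
  push_cast at h
  linear_combination -h

theorem coeff_polyR_pos {n : ℕ} (hn : 2 ≤ n) (d : ℝ) : 0 < (polyR n d).coeff n := by
  have h := coeff_polyR n d
  have h1 := coefA_pos hn
  have h2 := coeff_legendre_pos (n + 2)
  have : 0 < 3 * (polyR n d).coeff n := by rw [h]; positivity
  linarith

theorem polyR_ne_zero {n : ℕ} (hn : 2 ≤ n) (d : ℝ) : polyR n d ≠ 0 := by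
  intro h
  have := coeff_polyR_pos hn d
  simp [h] at this

theorem natDegree_polyR {n : ℕ} (hn : 2 ≤ n) (d : ℝ) : (polyR n d).natDegree = n :=
  (natDegree_polyR_le n d).antisymm (le_natDegree_of_ne_zero (coeff_polyR_pos hn d).ne')

/-- For the negative square root there is a root to the right of `1`. -/
theorem exists_root_polyR_neg {n : ℕ} (hn : 2 ≤ n) :
    ∃ x : ℝ, (polyR n (-delta n)).IsRoot x ∧ x ∉ Set.Icc (-1 : ℝ) 1 := by
  set p := polyR n (-delta n) with hp
  have hneg : p.eval 1 < 0 := by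
    rw [hp, eval_polyR (by norm_num), one_pow, one_mul]; exact valR_neg hn
  have hlead : 0 ≤ p.leadingCoeff := by
    rw [leadingCoeff, hp, natDegree_polyR hn]; exact (coeff_polyR_pos hn _).le
  have hdeg : 0 < p.degree := by
    rw [← natDegree_pos_iff_degree_pos, hp, natDegree_polyR hn]; omega
  have ht := p.tendsto_atTop_of_leadingCoeff_nonneg hdeg hlead
  obtain ⟨y, hy0, hy1⟩ := ((ht.eventually_ge_atTop 0).and (Filter.eventually_ge_atTop 1)).exists
  obtain ⟨x, hx, hx0⟩ := intermediate_value_Icc hy1 p.continuous.continuousOn ⟨hneg.le, hy0⟩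
  refine ⟨x, hx0, fun h => ?_⟩
  have : x = 1 := le_antisymm h.2 hx.1
  rw [this] at hx0
  exact hneg.ne hx0

end PolyR

/-! ### The polynomial `S_{n+1}` through Legendre derivatives. -/

section PolyS

/-- The coefficient of `(1 + x²) C_{n-1}` in `S_{n+1}`. -/
noncomputable def coefS₁ (n : ℕ) (d : ℝ) : ℝ :=
  (n : ℝ) * (6 * (n : ℝ) ^ 2 + 6 * n - 3 + 2 * (2 * n + 1) * d)

/-- The coefficient of `x C_{n-2}` in `S_{n+1}`, up to sign. -/
noncomputable def coefS₂ (n : ℕ) : ℝ := 4 * (2 * (n : ℝ) + 1) * (2 * (n : ℝ) ^ 2 + 6 * n + 1)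

/-- The coefficient of `(1 + x²) C_{n-3}` in `S_{n+1}`. -/
noncomputable def coefS₃ (n : ℕ) : ℝ := ((n : ℝ) + 2) * (2 * (n : ℝ) ^ 2 + 6 * n + 1)

theorem three_mul_polyS (k : ℕ) (d : ℝ) :
    3 * polyS (k + 1) d =
      derivative (derivative (legendre (k + 2))) * (C (coefS₁ (k + 1) d) * (1 + X ^ 2))
      - derivative (derivative (legendre (k + 1))) * (C (coefS₂ (k + 1)) * X)
      + derivative (derivative (legendre k)) * (C (coefS₃ (k + 1)) * (1 + X ^ 2)) := by
  have h1 := geg_sub_two (k + 2)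
  have h2 := geg_sub_two (k + 1)
  have h3 := geg_sub_two k
  rw [show ((k + 2 : ℕ) : ℤ) - 2 = ((k + 1 : ℕ) : ℤ) - 1 by push_cast; ring] at h1
  rw [show ((k : ℕ) : ℤ) - 2 = ((k + 1 : ℕ) : ℤ) - 3 by push_cast; ring] at h3
  simp only [polyS, coefS₁, coefS₂, coefS₃, ← h1, ← h2, ← h3]
  ring

end PolyS

/-! ### The functional `L` and the boundary identities behind orthogonality. -/

section Functional

/-- The functional `p ↦ ∫ p - c (p'(1) - p'(-1))` on polynomials. -/
noncomputable def functional (c : ℝ) : ℝ[X] →ₗ[ℝ] ℝ where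
  toFun p := integ p - c * ((derivative p).eval 1 - (derivative p).eval (-1))
  map_add' p q := by simp; ring
  map_smul' a p := by simp; ring

theorem functional_apply (c : ℝ) (p : ℝ[X]) :
    functional c p = integ p - c * ((derivative p).eval 1 - (derivative p).eval (-1)) := rfl

theorem functional_C_mul (c a : ℝ) (p : ℝ[X]) : functional c (C a * p) = a * functional c p := by
  rw [← smul_eq_C_mul, map_smul, smul_eq_mul]

/-- The constant of the functional that the quadrature rule reproduces. -/
noncomputable def boundaryCoeff (n : ℕ) : ℝ :=
  (coefB n (delta n) - coefA n) / (3 * valR n (delta n))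

theorem boundaryCoeff_mul {n : ℕ} (hn : 2 ≤ n) :
    3 * boundaryCoeff n * valR n (delta n) = coefB n (delta n) - coefA n := by
  have := (valR_pos hn).ne'
  rw [boundaryCoeff]
  field_simp

/-- This condition determines `boundaryCoeff`; by parity the same constant serves both endpoints. -/
theorem eval_primR_eq {n : ℕ} (hn : 2 ≤ n) {e : ℝ} (he : e * e = 1) :
    (primR n (delta n)).eval e = -(3 * boundaryCoeff n * (polyR n (delta n)).eval e) := by
  rw [eval_primR he, eval_polyR he]
  linear_combination e ^ n * boundaryCoeff_mul hn

theorem eval_derivative_primR_eq {n : ℕ} (hn : 2 ≤ n) {e : ℝ} (he : e * e = 1) :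
    (derivative (primR n (delta n))).eval e =
      3 * boundaryCoeff n * (derivative (polyR n (delta n))).eval e := by
  apply mul_left_cancel₀ (valR_pos hn).ne'
  rw [eval_derivative_primR he, eval_derivative_polyR he]
  have h := boundaryCoeff_mul hn
  have hd := delta_sq hn
  set c := boundaryCoeff n
  set d := delta n
  set N : ℝ := (n : ℝ)
  set E := e ^ n
  -- Eliminating `c` leaves an equation in `d` alone, a multiple of the quadratic `hd`. This is
  -- where the value of `δ` comes from.
  have key : valR n d * (coefA n * ((N + 2) * (N + 3) / 2) - coefB n d * (N * (N + 1) / 2)) =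
      (coefB n d - coefA n) * ((coefA n * (N * (N + 1) * (N + 2) * (N + 3) * (N + 4) * (N + 5)) -
        coefB n d * ((N - 2) * (N - 1) * N * (N + 1) * (N + 2) * (N + 3))) / 144) := by
    simp only [valR, coefA, coefB]
    linear_combination ((2 * N + 3) ^ 2 * (N + 3) * (N - 1) * (N + 1) * (N + 2) *
      (2 * N ^ 2 + 2 * N - 3) / 18) * hd
  linear_combination e * E * key - e * E *
    ((coefA n * (N * (N + 1) * (N + 2) * (N + 3) * (N + 4) * (N + 5)) -
        coefB n d * ((N - 2) * (N - 1) * N * (N + 1) * (N + 2) * (N + 3))) / 144) * h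

/-- `R_n` is orthogonal to all polynomials of degree at most `n + 1`. -/
theorem functional_polyR_mul {n : ℕ} (hn : 2 ≤ n) {q : ℝ[X]} (hq : q.natDegree ≤ n + 1) :
    functional (boundaryCoeff n) (polyR n (delta n) * q) = 0 := by
  set c := boundaryCoeff n
  set R := polyR n (delta n)
  set G := primR n (delta n)
  -- `G` involves only `P_{n+2}` and `P_n`, while `q''` has degree below `n`.
  have hint : integ (G * derivative (derivative q)) = 0 := by
    have hd : (derivative (derivative q)).natDegree < n := by
      have h1 := natDegree_derivative_le q
      have h2 := natDegree_derivative_le (derivative q)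
      omega
    simp only [G, primR]
    rw [sub_mul, map_sub, mul_assoc, mul_assoc, integ_C_mul, integ_C_mul,
      integ_legendre_mul_of_lt hd, integ_legendre_mul_of_lt (by omega)]
    ring
  have h := integ_derivative2_mul G q
  rw [hint, derivative2_primR, ← map_ofNat C 3, mul_assoc, integ_C_mul] at h
  have b : ∀ e : ℝ, e * e = 1 → (derivative G * q - G * derivative q).eval e =
      3 * c * (derivative (R * q)).eval e := by
    intro e he
    simp only [derivative_mul, eval_sub, eval_mul, eval_add]
    rw [eval_primR_eq hn he, eval_derivative_primR_eq hn he]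
    ring
  rw [b 1 (by norm_num), b (-1) (by norm_num)] at h
  rw [functional_apply]
  linear_combination h / 3

/-- The second derivatives have degree at most `k`, so only the `P_k` term survives, through its top
coefficient; `(k + 2)(k + 1)` comes from differentiating `x^(k+2)` twice. -/
theorem integ_legendre_second_mul {k : ℕ} {q : ℝ[X]} (hq : q.natDegree ≤ k)
    (a₁ a₂ a₃ : ℝ) :
    integ (legendre (k + 2) * derivative (derivative (C a₁ * (1 + X ^ 2) * q))
      - legendre (k + 1) * derivative (derivative (C a₂ * X * q))
      + legendre k * derivative (derivative (C a₃ * (1 + X ^ 2) * q))) =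
    a₃ * ((k + 2) * (k + 1)) * q.coeff k * integ (X ^ k * legendre k) := by
  have hs : ((1 + X ^ 2 : ℝ[X])).natDegree ≤ 2 := by compute_degree
  have h1 : ∀ a : ℝ, (derivative (derivative (C a * (1 + X ^ 2) * q))).natDegree ≤ k := by
    intro a
    have h1 := natDegree_derivative_le (C a * (1 + X ^ 2) * q)
    have h2 := natDegree_derivative_le (derivative (C a * (1 + X ^ 2) * q))
    have h3 : (C a * (1 + X ^ 2) * q).natDegree ≤ 2 + k :=
      natDegree_mul_le_of_le ((natDegree_C_mul_le _ _).trans hs) hq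
    omega
  have h2 : (derivative (derivative (C a₂ * X * q))).natDegree < k + 1 := by
    have h1 := natDegree_derivative_le (C a₂ * X * q)
    have h2 := natDegree_derivative_le (derivative (C a₂ * X * q))
    have h3 : (C a₂ * X * q).natDegree ≤ 1 + k :=
      natDegree_mul_le_of_le ((natDegree_C_mul_le _ _).trans natDegree_X_le) hq
    omega
  rw [map_add, map_sub, integ_legendre_mul_of_lt (lt_of_le_of_lt (h1 a₁) (by omega)),
    integ_legendre_mul_of_lt h2, integ_legendre_mul (h1 a₃), coeff_derivative, coeff_derivative,
    mul_assoc (C a₃), coeff_C_mul, add_mul, coeff_add, one_mul, add_assoc k 1 1,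
    coeff_X_pow_mul, coeff_eq_zero_of_natDegree_lt (by omega : q.natDegree < k + (1 + 1))]
  push_cast
  ring

/-- The coefficients of `S_{n+1}`, with `n = k + 1`, make the boundary terms of integration by parts
equal those of `L`. Both sides are linear in `q(e)` and `q'(e)`, and after `c` is eliminated they
differ by a multiple of the quadratic for `δ`. -/
theorem polyS_boundary {k : ℕ} (hk : 0 < k) {e : ℝ} (he : e * e = 1) (q : ℝ[X]) :
    (derivative (legendre (k + 2)) * (C (coefS₁ (k + 1) (delta (k + 1))) * (1 + X ^ 2) * q)
      - legendre (k + 2) * derivative (C (coefS₁ (k + 1) (delta (k + 1))) * (1 + X ^ 2) * q)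
      - (derivative (legendre (k + 1)) * (C (coefS₂ (k + 1)) * X * q)
        - legendre (k + 1) * derivative (C (coefS₂ (k + 1)) * X * q))
      + (derivative (legendre k) * (C (coefS₃ (k + 1)) * (1 + X ^ 2) * q)
        - legendre k * derivative (C (coefS₃ (k + 1)) * (1 + X ^ 2) * q))).eval e =
    boundaryCoeff (k + 1) * (derivative (3 * polyS (k + 1) (delta (k + 1)) * q)).eval e := by
  rw [three_mul_polyS]
  have hn : 2 ≤ k + 1 := by omega
  apply mul_left_cancel₀ (valR_pos hn).ne'
  have h := boundaryCoeff_mul hn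
  have hd := delta_sq hn
  have hv : valR (k + 1) (delta (k + 1)) =
    (((k + 1 : ℕ) : ℝ) - 1) * ((k + 1 : ℕ) + 1) * ((k + 1 : ℕ) + 2) * ((k + 1 : ℕ) + 3) *
      (2 * (k + 1 : ℕ) + 3) * ((k + 1 : ℕ) - 2 + (k + 1 : ℕ) * delta (k + 1)) / 12 := rfl
  set c := boundaryCoeff (k + 1)
  set d := delta (k + 1)
  set v := valR (k + 1) d
  have he' : e = 1 ∨ e = -1 := mul_self_eq_one_iff.mp he
  simp only [derivative_add, derivative_sub, derivative_mul, derivative_C, derivative_X,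
    derivative_one, derivative_X_pow, eval_add, eval_sub, eval_mul, eval_C,
    eval_X, eval_one, eval_pow, eval_zero, eval_legendre he,
    eval_derivative_legendre he, eval_derivative2_legendre he, eval_derivative3_legendre he, pow_succ]
  generalize q.eval e = q₀
  generalize (derivative q).eval e = q₁
  generalize e ^ k = t
  have hc : ∀ W : ℝ, v * (c * W) = (coefB (k + 1) d - coefA (k + 1)) / 3 * W := fun W => by
    linear_combination W / 3 * h
  rw [hc, hv]
  simp only [coefA, coefB, coefS₁, coefS₂, coefS₃]
  push_cast at hd ⊢
  clear_value c d v
  generalize (k : ℝ) = K at *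
  rcases he' with rfl | rfl
  · linear_combination (K + 1) * (2 * K + 3) * (2 * K + 5) * (K + 2) * (K + 3) *
      ((2 * (K + 1) ^ 2 + 1) * (K + 4) * t * q₀ / 9 + 4 / 3 * t * q₁) * hd
  · linear_combination (K + 1) * (2 * K + 3) * (2 * K + 5) * (K + 2) * (K + 3) *
      (-(2 * (K + 1) ^ 2 + 1) * (K + 4) * t * q₀ / 9 + 4 / 3 * t * q₁) * hd

end Functional
end SplineQuad

namespace SplineQuad

/-! ### Orthogonality of `S_{n+1}` and the constant `A`. -/

section Orthogonality

/-- `S_{n+1}` is orthogonal to all polynomials of degree at most `n - 2`, and its product with a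
polynomial of degree `n - 1` only sees the top coefficient. -/
theorem functional_polyS_mul {k : ℕ} (hk : 0 < k) {q : ℝ[X]} (hq : q.natDegree ≤ k) :
    3 * functional (boundaryCoeff (k + 1)) (polyS (k + 1) (delta (k + 1)) * q) =
      coefS₃ (k + 1) * ((k + 2) * (k + 1)) * q.coeff k * integ (X ^ k * legendre k) := by
  have h1 := integ_derivative2_mul (legendre (k + 2))
    (C (coefS₁ (k + 1) (delta (k + 1))) * (1 + X ^ 2) * q)
  have h2 := integ_derivative2_mul (legendre (k + 1)) (C (coefS₂ (k + 1)) * X * q)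
  have h3 := integ_derivative2_mul (legendre k) (C (coefS₃ (k + 1)) * (1 + X ^ 2) * q)
  have h4 := integ_legendre_second_mul hq (coefS₁ (k + 1) (delta (k + 1))) (coefS₂ (k + 1))
    (coefS₃ (k + 1))
  have b1 := polyS_boundary hk (e := 1) (by norm_num) q
  have b2 := polyS_boundary hk (e := -1) (by norm_num) q
  rw [← functional_C_mul, map_ofNat, ← mul_assoc, functional_apply]
  have h5 : integ (3 * polyS (k + 1) (delta (k + 1)) * q) =
      integ (derivative (derivative (legendre (k + 2))) *
          (C (coefS₁ (k + 1) (delta (k + 1))) * (1 + X ^ 2) * q))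
        - integ (derivative (derivative (legendre (k + 1))) * (C (coefS₂ (k + 1)) * X * q))
        + integ (derivative (derivative (legendre k)) *
          (C (coefS₃ (k + 1)) * (1 + X ^ 2) * q)) := by
    rw [← map_sub, ← map_add, three_mul_polyS]
    congr 1
    ring
  rw [map_add, map_sub] at h4
  rw [h5, h1, h2, h3]
  simp only [eval_add, eval_sub] at b1 b2 ⊢
  linear_combination h4 + b1 - b2

/-- With `k = n - 1`, three ratios of leading coefficients lead from `P_{k+3}`, which governs the
leading coefficient of `R_n`, down to `P_k`; the norm of `P_k` then evaluates the product. -/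
theorem functional_polyS_mul_eq_constA {n : ℕ} (hn : 2 ≤ n) {q : ℝ[X]} (hq : q.natDegree ≤ n - 1)
    (hlead : q.coeff (n - 1) = (polyR n (delta n)).coeff n) :
    functional (boundaryCoeff n) (polyS n (delta n) * q) = constA n := by
  obtain ⟨k, rfl⟩ := Nat.exists_eq_succ_of_ne_zero (by omega : n ≠ 0)
  simp only [Nat.succ_eq_add_one, Nat.add_sub_cancel] at *
  have h1 := functional_polyS_mul (by omega : 0 < k) hq
  have h2 := coeff_polyR (k + 1) (delta (k + 1))
  have h3 := coeff_legendre_succ k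
  have h4 := coeff_legendre_succ (k + 1)
  have h5 := coeff_legendre_succ (k + 2)
  have h6 := integ_X_pow_mul_legendre_mul_coeff k
  rw [hlead] at h1
  rw [show k + 1 + 2 = k + 2 + 1 from rfl] at h2
  rw [show k + 1 + 1 = k + 2 from rfl] at h4
  generalize functional (boundaryCoeff (k + 1)) (polyS (k + 1) (delta (k + 1)) * q) = L at *
  generalize (polyR (k + 1) (delta (k + 1))).coeff (k + 1) = r at *
  generalize integ (X ^ k * legendre k) = I at *
  generalize (legendre (k + 2 + 1)).coeff (k + 2 + 1) = l3 at *
  generalize (legendre (k + 2)).coeff (k + 2) = l2 at *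
  generalize (legendre (k + 1)).coeff (k + 1) = l1 at *
  generalize (legendre k).coeff k = l0 at *
  simp only [coefS₃, coefA, constA] at *
  push_cast at *
  generalize (k : ℝ) = K at *
  set g := (K + 1 + 2) * (2 * (K + 1) ^ 2 + 6 * (K + 1) + 1)
  set a := (K + 1 - 1) * (2 * (K + 1) ^ 2 + 2 * (K + 1) - 3)
  linear_combination h1 / 3 + g * (K + 2) * (K + 1) * I / 9 * h2 +
    g * a * (K + 2) * I / 9 *
      ((K + 2) * (K + 1) * h5 + (2 * K + 5) * (K + 1) * h4 + (2 * K + 5) * (2 * K + 3) * h3) +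
    g * a * (K + 2) * (2 * K + 5) * (2 * K + 3) / 9 * h6

theorem constA_pos {n : ℕ} (hn : 2 ≤ n) : 0 < constA n := by
  have h2 : (2 : ℝ) ≤ n := by exact_mod_cast hn
  have h1 : (0 : ℝ) < n - 1 := by linarith
  have h3 : (0 : ℝ) < 2 * (n : ℝ) ^ 2 + 2 * n - 3 := by nlinarith
  unfold constA
  positivity

end Orthogonality

/-! ### Location and simplicity of the roots of `R_n`. -/

section Roots

theorem eval_prod_X_sub_C (Z : Finset ℝ) (x : ℝ) :
    (∏ z ∈ Z, (X - C z)).eval x = ∏ z ∈ Z, (x - z) := by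
  simp [eval_prod]

/-- A polynomial becomes of constant sign on `[-1, 1]` after multiplication with a product of
distinct linear factors at roots in `(-1, 1)`. -/
theorem exists_finset_constant_sign (p : ℝ[X]) (hp : p ≠ 0) :
    ∃ Z : Finset ℝ, (∀ z ∈ Z, z ∈ Set.Ioo (-1 : ℝ) 1 ∧ p.IsRoot z) ∧
      ((∀ x ∈ Set.Icc (-1 : ℝ) 1, 0 ≤ (p * ∏ z ∈ Z, (X - C z)).eval x) ∨
        (∀ x ∈ Set.Icc (-1 : ℝ) 1, (p * ∏ z ∈ Z, (X - C z)).eval x ≤ 0)) := by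
  induction hd : p.natDegree using Nat.strong_induction_on generalizing p with
  | _ d ih =>
  by_cases h : ∃ z ∈ Set.Ioo (-1 : ℝ) 1, p.IsRoot z
  · obtain ⟨z, hz, hroot⟩ := h
    obtain ⟨p₁, rfl⟩ := dvd_iff_isRoot.mpr hroot
    have hp₁ : p₁ ≠ 0 := right_ne_zero_of_mul hp
    have hdeg : p₁.natDegree < d := by
      rw [← hd, natDegree_mul (X_sub_C_ne_zero z) hp₁, natDegree_X_sub_C]; omega
    obtain ⟨Z, hZ, hsign⟩ := ih _ hdeg p₁ hp₁ rfl
    -- Splitting off a factor `X - z` toggles the membership of `z`: `Z` keeps the roots of odd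
    -- multiplicity.
    by_cases hzZ : z ∈ Z
    · refine ⟨Z.erase z, fun y hy => ?_, ?_⟩
      · have := hZ y (Finset.mem_of_mem_erase hy)
        exact ⟨this.1, root_mul_left_of_isRoot _ this.2⟩
      · have e : (X - C z) * p₁ * ∏ y ∈ Z.erase z, (X - C y) = p₁ * ∏ y ∈ Z, (X - C y) := by
          rw [← Finset.mul_prod_erase Z _ hzZ]; ring
        rwa [e]
    · refine ⟨insert z Z, fun y hy => ?_, ?_⟩
      · rcases Finset.mem_insert.mp hy with rfl | hy
        · exact ⟨hz, hroot⟩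
        · exact ⟨(hZ y hy).1, root_mul_left_of_isRoot _ (hZ y hy).2⟩
      · have e : ∀ x, ((X - C z) * p₁ * ∏ y ∈ insert z Z, (X - C y)).eval x =
            (x - z) ^ 2 * (p₁ * ∏ y ∈ Z, (X - C y)).eval x := by
          intro x
          rw [Finset.prod_insert hzZ]
          simp only [eval_mul, eval_sub, eval_X, eval_C]
          ring
        simp only [e]
        exact hsign.imp (fun h x hx => mul_nonneg (sq_nonneg _) (h x hx))
          (fun h x hx => mul_nonpos_of_nonneg_of_nonpos (sq_nonneg _) (h x hx))
  · refine ⟨∅, by simp, ?_⟩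
    by_contra! hcon
    obtain ⟨⟨x, hx, hx0⟩, y, hy, hy0⟩ := hcon
    simp only [Finset.prod_empty, mul_one] at hx0 hy0
    obtain ⟨z, hz, hz0⟩ := intermediate_value_uIcc (p.continuous.continuousOn (s := Set.uIcc x y))
      (Set.mem_uIcc.mpr (Or.inl ⟨hx0.le, hy0.le⟩))
    refine h ⟨z, ?_, hz0⟩
    have hzx : z ≠ x := by rintro rfl; exact hx0.ne hz0
    have hzy : z ≠ y := by rintro rfl; exact hy0.ne' hz0
    rcases Set.mem_uIcc.mp hz with hz | hz
    · exact ⟨lt_of_le_of_lt hx.1 (lt_of_le_of_ne hz.1 hzx.symm),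
        lt_of_lt_of_le (lt_of_le_of_ne hz.2 hzy) hy.2⟩
    · exact ⟨lt_of_le_of_lt hy.1 (lt_of_le_of_ne hz.1 hzy.symm),
        lt_of_lt_of_le (lt_of_le_of_ne hz.2 hzx) hx.2⟩

theorem integ_pos {p : ℝ[X]} (hp : p ≠ 0) (h : ∀ x ∈ Set.Icc (-1 : ℝ) 1, 0 ≤ p.eval x) :
    0 < integ p := by
  refine intervalIntegral.integral_pos (by norm_num) p.continuous.continuousOn
    (fun x hx => h x (Set.Ioc_subset_Icc_self hx)) ?_
  by_contra! hcon
  refine hp (eq_zero_of_infinite_isRoot p ((Set.Icc_infinite (by norm_num : (-1 : ℝ) < 1)).mono ?_))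
  exact fun x hx => le_antisymm (hcon x hx) (h x hx)

/-- The double zeros of the weight at `±1` remove the boundary terms. The `C_n` part of `R_n` is
orthogonal to `h`, and the `C_{n-2}` part, entering with coefficient `-coefB < 0`, sees only the
coefficient of `x^(n-2)` in `h`, which is `0` or `1`. -/
theorem integ_polyR_mul_weight_nonpos {n : ℕ} (hn : 2 ≤ n) {h : ℝ[X]} (hm : h.Monic)
    (hdeg : h.natDegree ≤ n - 2) :
    integ (polyR n (delta n) * (h * (X ^ 2 - 1) ^ 2)) ≤ 0 := by
  set W := h * (X ^ 2 - 1) ^ 2 with hW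
  have hw : ((X : ℝ[X]) ^ 2 - 1).Monic := by
    rw [← C_1]; exact monic_X_pow_sub_C _ (by norm_num)
  have hWm : W.Monic := hm.mul (hw.pow 2)
  have hWd : W.natDegree = h.natDegree + 4 := by
    rw [hW, hm.natDegree_mul (hw.pow 2), hw.natDegree_pow, ← C_1, natDegree_X_pow_sub_C]
  have hW2 : (derivative (derivative W)).natDegree ≤ n := by
    have h1 := natDegree_derivative_le W
    have h2 := natDegree_derivative_le (derivative W)
    omega
  have hcoef : 0 ≤ W.coeff (n + 2) := by
    rcases (by omega : W.natDegree ≤ n + 2).lt_or_eq with hlt | heq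
    · rw [coeff_eq_zero_of_natDegree_lt hlt]
    · rw [← heq, coeff_natDegree, hWm.leadingCoeff]; norm_num
  have hb : ∀ e : ℝ, e * e = 1 → (derivative (primR n (delta n)) * W
      - primR n (delta n) * derivative W).eval e = 0 := by
    intro e he
    have he' : e ^ 2 - 1 = 0 := by linear_combination he
    simp [hW, derivative_mul, he', derivative_pow]
  have key := integ_derivative2_mul (primR n (delta n)) W
  rw [hb 1 (by norm_num), hb (-1) (by norm_num), derivative2_primR, ← map_ofNat C 3, mul_assoc,
    integ_C_mul, show primR n (delta n) * derivative (derivative W) =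
      C (coefA n) * (legendre (n + 2) * derivative (derivative W)) -
      C (coefB n (delta n)) * (legendre n * derivative (derivative W)) by rw [primR]; ring,
    map_sub, integ_C_mul, integ_C_mul,
    integ_legendre_mul_of_lt (by omega), integ_legendre_mul hW2, coeff_derivative,
    coeff_derivative] at key
  have hB := coefB_pos hn
  have hI := integ_X_pow_mul_legendre_pos n
  have : 0 ≤ coefB n (delta n) * (W.coeff (n + 1 + 1) * (((n + 1 : ℕ) : ℝ) + 1) * ((n : ℝ) + 1) *
      integ (X ^ n * legendre n)) := by
    have := hcoef
    rw [show n + 2 = n + 1 + 1 from rfl] at this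
    positivity
  linarith

/-- `R_n` has `n` distinct roots in `(-1, 1)`. -/
theorem exists_finset_roots {n : ℕ} (hn : 2 ≤ n) :
    ∃ Z : Finset ℝ, Z.card = n ∧ ∀ z ∈ Z, z ∈ Set.Ioo (-1 : ℝ) 1 ∧
      (polyR n (delta n)).IsRoot z := by
  set R := polyR n (delta n) with hR
  have hR0 : R ≠ 0 := polyR_ne_zero hn _
  obtain ⟨Z, hZ, hsign⟩ := exists_finset_constant_sign R hR0
  refine ⟨Z, ?_, hZ⟩
  set h : ℝ[X] := ∏ z ∈ Z, (X - C z) with hh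
  have hmon : h.Monic := monic_prod_of_monic _ _ fun z _ => monic_X_sub_C z
  have hdeg : h.natDegree = Z.card := by
    rw [hh, natDegree_prod_of_monic _ _ fun z _ => monic_X_sub_C z]; simp
  have hv := valR_pos hn
  have h1 : 0 < (R * h).eval 1 := by
    rw [eval_mul, hR, eval_polyR (by norm_num), one_pow, one_mul, hh, eval_prod_X_sub_C]
    exact mul_pos hv (Finset.prod_pos fun z hz => sub_pos.mpr (hZ z hz).1.2)
  have hpos : ∀ x ∈ Set.Icc (-1 : ℝ) 1, 0 ≤ (R * h).eval x := by
    rcases hsign with hs | hs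
    · exact hs
    · exact absurd (hs 1 (by norm_num)) (not_le.mpr h1)
  have hcard : Z.card ≤ n := by
    rw [← natDegree_polyR hn (delta n)]
    refine (Finset.card_le_card (t := R.roots.toFinset) fun z hz => ?_).trans
      ((Multiset.toFinset_card_le _).trans (card_roots' _))
    rw [Multiset.mem_toFinset, mem_roots hR0]
    exact (hZ z hz).2
  -- `R_n(-1) = (-1)^n R_n(1) ≠ 0`, so the number of sign changes has the parity of `n`. This
  -- excludes `n - 1`, for which the integral test would not apply.
  have heven : Even (n + Z.card) := by
    by_contra hodd
    rw [Nat.not_even_iff_odd] at hodd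
    have h2 := hpos (-1) (by norm_num)
    have h3 : ∏ z ∈ Z, (-1 - z) = (-1) ^ Z.card * ∏ z ∈ Z, (z + 1) := by
      rw [← Finset.prod_const, ← Finset.prod_mul_distrib]
      exact Finset.prod_congr rfl fun z _ => by ring
    have h4 : 0 < ∏ z ∈ Z, (z + 1) :=
      Finset.prod_pos fun z hz => by linarith [(hZ z hz).1.1]
    rw [eval_mul, hR, eval_polyR (by norm_num), hh, eval_prod_X_sub_C, h3,
      show (-1 : ℝ) ^ n * valR n (delta n) * ((-1) ^ Z.card * ∏ z ∈ Z, (z + 1)) =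
        (-1) ^ (n + Z.card) * (valR n (delta n) * ∏ z ∈ Z, (z + 1)) by ring,
      hodd.neg_one_pow] at h2
    have := mul_pos hv h4
    linarith
  by_contra hne
  have hle : Z.card ≤ n - 2 := by
    obtain ⟨r, hr⟩ := heven
    omega
  have hw : ((X : ℝ[X]) ^ 2 - 1) ≠ 0 := by
    rw [← C_1]; exact (monic_X_pow_sub_C _ (by norm_num)).ne_zero
  have h5 := integ_polyR_mul_weight_nonpos hn hmon (hdeg.trans_le hle)
  have h6 : 0 < integ (R * (h * (X ^ 2 - 1) ^ 2)) := by
    refine integ_pos (mul_ne_zero hR0 (mul_ne_zero hmon.ne_zero (pow_ne_zero _ hw)))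
      fun x hx => ?_
    rw [← mul_assoc, eval_mul, eval_pow]
    exact mul_nonneg (hpos x hx) (sq_nonneg _)
  linarith

theorem mem_nodes {n : ℕ} (hn : 2 ≤ n) {x : ℝ} :
    x ∈ nodes n ↔ (polyR n (delta n)).IsRoot x := by
  rw [nodes, Multiset.mem_toFinset, mem_roots (polyR_ne_zero hn _)]

theorem card_nodes_le {n : ℕ} (hn : 2 ≤ n) : (nodes n).card ≤ n := by
  rw [nodes]
  refine (Multiset.toFinset_card_le _).trans ((card_roots' _).trans_eq (natDegree_polyR hn _))

theorem card_nodes_and_mem_Ioo {n : ℕ} (hn : 2 ≤ n) :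
    (nodes n).card = n ∧ ∀ x ∈ nodes n, x ∈ Set.Ioo (-1 : ℝ) 1 := by
  obtain ⟨Z, hcard, hZ⟩ := exists_finset_roots hn
  have hsub : Z ⊆ nodes n := fun z hz => (mem_nodes hn).mpr (hZ z hz).2
  have heq : Z = nodes n := Finset.eq_of_subset_of_card_le hsub (by
    rw [hcard]; exact card_nodes_le hn)
  exact ⟨heq ▸ hcard, fun x hx => (hZ x (heq ▸ hx)).1⟩

theorem eval_derivative_polyR_ne_zero {n : ℕ} (hn : 2 ≤ n) {x : ℝ} (hx : x ∈ nodes n) :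
    (derivative (polyR n (delta n))).eval x ≠ 0 := by
  have hR0 := polyR_ne_zero hn (delta n)
  have hnodup : (polyR n (delta n)).roots.Nodup := by
    rw [← Multiset.toFinset_card_eq_card_iff_nodup]
    refine le_antisymm (Multiset.toFinset_card_le _) ?_
    refine (card_roots' _).trans ?_
    rw [natDegree_polyR hn]
    exact (card_nodes_and_mem_Ioo hn).1.ge
  intro h
  have h1 := (one_lt_rootMultiplicity_iff_isRoot hR0).mpr ⟨(mem_nodes hn).mp hx, h⟩
  have h2 := Multiset.nodup_iff_count_le_one.mp hnodup x
  rw [count_roots] at h2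
  omega

end Roots

/-! ### Gauss quadrature for `L` on one interval. -/

section Quadrature

theorem natDegree_polyS_le {n : ℕ} (hn : n ≠ 0) (d : ℝ) : (polyS n d).natDegree ≤ n + 1 := by
  obtain ⟨k, rfl⟩ := Nat.exists_eq_succ_of_ne_zero hn
  have hs : ((1 + X ^ 2 : ℝ[X])).natDegree ≤ 2 := by compute_degree
  have hP : ∀ m, (derivative (derivative (legendre m))).natDegree ≤ m - 2 := by
    intro m
    have h1 := natDegree_derivative_le (legendre m)
    have h2 := natDegree_derivative_le (derivative (legendre m))
    have h3 := natDegree_legendre_le m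
    omega
  have h : (C (3 : ℝ) * polyS (k + 1) d).natDegree ≤ k + 2 := by
    rw [map_ofNat, three_mul_polyS]
    refine (natDegree_add_le_of_le (natDegree_sub_le_of_le
      (natDegree_mul_le_of_le (hP _) ((natDegree_C_mul_le _ _).trans hs))
      (natDegree_mul_le_of_le (hP _) ((natDegree_C_mul_le _ _).trans natDegree_X_le)))
      (natDegree_mul_le_of_le (hP _) ((natDegree_C_mul_le _ _).trans hs))).trans ?_
    omega
  rwa [natDegree_C_mul (by norm_num)] at h

/-- For a root `x` of `R_n`, the functional of `R_n / (X - x)` times `S_{n+1}(x)` is `A`. -/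
theorem functional_divByMonic_mul {n : ℕ} (hn : 2 ≤ n) {x : ℝ} (hx : x ∈ nodes n) :
    functional (boundaryCoeff n) (polyR n (delta n) /ₘ (X - C x)) * (polyS n (delta n)).eval x =
      constA n := by
  set R := polyR n (delta n)
  set S := polyS n (delta n)
  set q := R /ₘ (X - C x)
  have hRq : (X - C x) * q = R := mul_divByMonic_eq_iff_isRoot.mpr ((mem_nodes hn).mp hx)
  have hqd : q.natDegree ≤ n - 1 := by
    rw [natDegree_divByMonic _ (monic_X_sub_C x), natDegree_X_sub_C]
    have : R.natDegree = n := natDegree_polyR hn _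
    omega
  have hlead : q.coeff (n - 1) = R.coeff n := by
    obtain ⟨k, rfl⟩ := Nat.exists_eq_succ_of_ne_zero (by omega : n ≠ 0)
    simp only [Nat.succ_eq_add_one, Nat.add_sub_cancel] at *
    rw [← hRq, sub_mul, coeff_sub, coeff_X_mul, coeff_C_mul,
      coeff_eq_zero_of_natDegree_lt (by omega : q.natDegree < k + 1)]
    ring
  rw [← functional_polyS_mul_eq_constA hn hqd hlead]
  have hS : C (S.eval x) + (X - C x) * (S /ₘ (X - C x)) = S := by
    rw [← modByMonic_X_sub_C_eq_C_eval]
    exact modByMonic_add_div S (X - C x)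
  have hT : (S /ₘ (X - C x)).natDegree ≤ n + 1 := by
    rw [natDegree_divByMonic _ (monic_X_sub_C x), natDegree_X_sub_C]
    have : S.natDegree ≤ n + 1 := natDegree_polyS_le (by omega) _
    omega
  -- Modulo `X - x` the factor `S` is its value at `x`; the rest is a multiple of `R` of low enough
  -- degree for `L` to vanish on it.
  have e : S * q = C (S.eval x) * q + R * (S /ₘ (X - C x)) := by
    linear_combination -q * hS + (S /ₘ (X - C x)) * hRq
  rw [e, map_add, functional_C_mul, functional_polyR_mul hn hT]
  ring

theorem eval_polyS_ne_zero {n : ℕ} (hn : 2 ≤ n) {x : ℝ} (hx : x ∈ nodes n) :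
    (polyS n (delta n)).eval x ≠ 0 := by
  intro h
  have h1 := functional_divByMonic_mul hn hx
  rw [h, mul_zero] at h1
  exact (constA_pos hn).ne h1

theorem eval_divByMonic_root (p : ℝ[X]) {x : ℝ} (hx : p.IsRoot x) :
    (p /ₘ (X - C x)).eval x = (derivative p).eval x := by
  have h := congrArg (fun q => (derivative q).eval x) (mul_divByMonic_eq_iff_isRoot.mpr hx)
  simpa [derivative_mul] using h

theorem eval_divByMonic_root_of_ne (p : ℝ[X]) {x y : ℝ} (hx : p.IsRoot x) (hy : p.IsRoot y)
    (hxy : y ≠ x) : (p /ₘ (X - C x)).eval y = 0 := by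
  have h := congrArg (eval y) (mul_divByMonic_eq_iff_isRoot.mpr hx)
  rw [eval_mul, hy, eval_sub, eval_X, eval_C] at h
  exact (mul_eq_zero.mp h).resolve_left (sub_ne_zero.mpr hxy)

/-- The rule on `[-1, 1]` reproduces the functional on polynomials of degree at most `2 n + 1`. -/
theorem sum_weight_mul_eval {n : ℕ} (hn : 2 ≤ n) {p : ℝ[X]} (hp : p.natDegree ≤ 2 * n + 1) :
    ∑ x ∈ nodes n, weight n x * p.eval x = functional (boundaryCoeff n) p := by
  set R := polyR n (delta n) with hR
  have hR0 : R ≠ 0 := polyR_ne_zero hn _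
  have hRd : R.natDegree = n := natDegree_polyR hn _
  have hcard := (card_nodes_and_mem_Ioo hn).1
  have hdiv : R * (p / R) + p % R = p := EuclideanDomain.div_add_mod p R
  -- The degree `2 n + 1 - n = n + 1` is exactly the range of the orthogonality of `R_n`.
  have hquot : (p / R).natDegree ≤ n + 1 := by
    rw [div_def, natDegree_C_mul (inv_ne_zero (leadingCoeff_ne_zero.mpr hR0)),
      natDegree_divByMonic _ (monic_mul_leadingCoeff_inv hR0), natDegree_mul_leadingCoeff_inv _ hR0]
    omega
  have hroot : ∀ x ∈ nodes n, R.IsRoot x := fun x hx => (mem_nodes hn).mp hx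
  -- Lagrange interpolation at the nodes, where the remainder takes the values of `p`.
  have hinterp : p % R = ∑ x ∈ nodes n,
      C (p.eval x / (derivative R).eval x) * (R /ₘ (X - C x)) := by
    refine eq_of_degrees_lt_of_eval_finset_eq (nodes n) ?_ ?_ fun y hy => ?_
    · rw [hcard, ← hRd, ← degree_eq_natDegree hR0]
      exact EuclideanDomain.mod_lt p hR0
    · refine lt_of_le_of_lt (degree_sum_le _ _) ?_
      rw [Finset.sup_lt_iff (by rw [hcard]; exact WithBot.bot_lt_coe n)]
      intro x hx
      have h1 : (R /ₘ (X - C x)).degree < R.degree :=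
        degree_divByMonic_lt R _ hR0 (by rw [degree_X_sub_C]; norm_num)
      rw [hcard, ← hRd, ← degree_eq_natDegree hR0, ← smul_eq_C_mul]
      exact (degree_smul_le _ _).trans_lt h1
    · rw [eval_finsetSum, Finset.sum_eq_single y]
      · rw [eval_mul, eval_C, eval_divByMonic_root R (hroot y hy),
          div_mul_cancel₀ _ (eval_derivative_polyR_ne_zero hn hy)]
        conv_rhs => rw [← hdiv, eval_add, eval_mul, hroot y hy, zero_mul, zero_add]
      · intro x hx hxy
        rw [eval_mul, eval_divByMonic_root_of_ne R (hroot x hx) (hroot y hy) hxy.symm, mul_zero]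
      · exact fun h => absurd hy h
  conv_rhs => rw [← hdiv, map_add, functional_polyR_mul hn hquot, zero_add, hinterp, map_sum]
  refine Finset.sum_congr rfl fun x hx => ?_
  rw [functional_C_mul, weight, ← functional_divByMonic_mul hn hx]
  have h1 := eval_derivative_polyR_ne_zero hn hx
  have h2 := eval_polyS_ne_zero hn hx
  rw [← hR] at h1 ⊢
  field_simp

end Quadrature
end SplineQuad

namespace SplineQuad

/-! ### From one interval to splines on the real line. -/

section Spline

theorem derivative_eval_eq_deriv {g : ℝ → ℝ} {q : ℝ[X]} {e : ℝ} (he : e ∈ Set.Icc (-1 : ℝ) 1)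
    (hg : DifferentiableAt ℝ g e) (h : ∀ x ∈ Set.Icc (-1 : ℝ) 1, g x = q.eval x) :
    (derivative q).eval e = deriv g e := by
  have h1 : HasDerivWithinAt g ((derivative q).eval e) (Set.Icc (-1 : ℝ) 1) e :=
    (q.hasDerivAt e).hasDerivWithinAt.congr h (h e he)
  exact (uniqueDiffOn_Icc (by norm_num) e he).eq_deriv _ h1 hg.hasDerivAt.hasDerivWithinAt

/-- A linear functional on polynomials of bounded degree is bounded for the `L¹` norm. -/
theorem exists_abs_le_integral_abs (φ : ℝ[X] →ₗ[ℝ] ℝ) (D : ℕ) :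
    ∃ M : ℝ, ∀ q : ℝ[X], q.natDegree ≤ D → |φ q| ≤ M * ∫ x in (-1 : ℝ)..1, |q.eval x| := by
  obtain ⟨g, hg⟩ := exists_integ_mul_eq φ D
  obtain ⟨M, hM⟩ := (isCompact_Icc (a := (-1 : ℝ)) (b := 1)).exists_bound_of_continuousOn
    g.continuous.continuousOn
  refine ⟨M, fun q hq => ?_⟩
  rw [hg q hq, integ_apply, ← intervalIntegral.integral_const_mul]
  refine (intervalIntegral.abs_integral_le_integral_abs (by norm_num)).trans ?_
  have hq' : Continuous fun x => |q.eval x| := q.continuous.abs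
  refine intervalIntegral.integral_mono_on (by norm_num)
    ((q * g).continuous.abs.intervalIntegrable _ _)
    ((continuous_const.mul hq').intervalIntegrable _ _) fun x hx => ?_
  rw [eval_mul, abs_mul, mul_comm]
  exact mul_le_mul_of_nonneg_right (hM x hx) (abs_nonneg _)

theorem hasSum_integral_translates {f : ℝ → ℝ} (hf : Integrable f) :
    HasSum (fun k : ℤ => ∫ x in (-1 : ℝ)..1, f (x + 2 * k)) (∫ t, f t) := by
  have h := hasSum_integral_iUnion (μ := volume) (f := f)
    (s := fun k : ℤ => Set.Ioc ((-1 : ℝ) + k • (2 : ℝ)) (-1 + (k + 1) • (2 : ℝ)))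
    (fun _ => measurableSet_Ioc) (Set.pairwise_disjoint_Ioc_add_zsmul (-1 : ℝ) 2)
    hf.integrableOn
  rw [iUnion_Ioc_add_zsmul (by norm_num : (0 : ℝ) < 2), setIntegral_univ] at h
  refine (congrArg (fun g : ℤ → ℝ => HasSum g _) (funext fun k => ?_)).mpr h
  rw [intervalIntegral.integral_comp_add_right, intervalIntegral.integral_of_le (by linarith),
    zsmul_eq_mul, zsmul_eq_mul]
  congr 3
  · ring
  · push_cast; ring

theorem hasSum_telescope {a : ℤ → ℝ} (ha : Summable a) :
    HasSum (fun k => a (k + 1) - a k) 0 := by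
  have h := ((Equiv.addRight (1 : ℤ)).hasSum_iff.mpr ha.hasSum).sub ha.hasSum
  simpa using h

theorem isExactC1_nodes {n : ℕ} (hn : 2 ≤ n) :
    IsExactC1 (2 * n + 1) (nodes n) (weight n) := by
  rintro f ⟨hf, hpoly⟩ hint
  choose p hpd hp using hpoly
  set q : ℤ → ℝ[X] := fun k => (p k).comp (X + C (2 * (k : ℝ))) with hq
  have hqd : ∀ k, (q k).natDegree ≤ 2 * n + 1 := fun k => by
    rw [hq, natDegree_comp, natDegree_X_add_C, mul_one]
    exact hpd k
  have hqf : ∀ k : ℤ, ∀ x ∈ Set.Icc (-1 : ℝ) 1, f (x + 2 * k) = (q k).eval x := by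
    intro k x hx
    rw [hp k _ ⟨by linarith [hx.1], by linarith [hx.2]⟩]
    simp [hq]
  have hdiff : Differentiable ℝ f := hf.differentiable (by norm_num)
  set a : ℤ → ℝ := fun k => deriv f (-1 + 2 * k) with ha
  have hder : ∀ k : ℤ, ∀ e ∈ Set.Icc (-1 : ℝ) 1,
      (derivative (q k)).eval e = deriv f (e + 2 * k) := by
    intro k e he
    rw [derivative_eval_eq_deriv he (g := fun x => f (x + 2 * k)) (by fun_prop) (hqf k),
      deriv_comp_add_const]
  have hleft : ∀ k, (derivative (q k)).eval (-1) = a k := fun k => hder k (-1) (by norm_num)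
  have hright : ∀ k, (derivative (q k)).eval 1 = a (k + 1) := fun k => by
    rw [hder k 1 (by norm_num), ha]
    congr 1
    push_cast
    ring
  -- The derivative at a knot is at most `M` times the integral of `|f|` over the interval to its
  -- right, since `f` is a polynomial of bounded degree there; integrability of `f` makes these
  -- integrals summable.
  have hasum : Summable a := by
    obtain ⟨M, hM⟩ := exists_abs_le_integral_abs ((leval (-1)).comp derivative) (2 * n + 1)
    refine Summable.of_abs (Summable.of_nonneg_of_le (fun k => abs_nonneg _) (fun k => ?_)
      ((hasSum_integral_translates hint.abs).summable.mul_left M))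
    have h := hM (q k) (hqd k)
    rw [LinearMap.comp_apply, leval_apply, hleft] at h
    refine h.trans_eq ?_
    congr 1
    refine intervalIntegral.integral_congr fun x hx => ?_
    rw [Set.uIcc_of_le (by norm_num)] at hx
    simp only [hqf k x hx]
  -- The boundary terms of `L` telescope, so subtracting them leaves the total integral unchanged.
  have hsum := (hasSum_integral_translates hint).sub
    ((hasSum_telescope hasum).mul_left (boundaryCoeff n))
  rw [mul_zero, sub_zero] at hsum
  refine (congrArg (fun g : ℤ → ℝ => HasSum g _) (funext fun k => ?_)).mpr hsum
  have h1 : ∑ x ∈ nodes n, weight n x * f (x + 2 * k) =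
      ∑ x ∈ nodes n, weight n x * (q k).eval x :=
    Finset.sum_congr rfl fun x hx => by
      rw [hqf k x (Set.Ioo_subset_Icc_self ((card_nodes_and_mem_Ioo hn).2 x hx))]
  rw [h1, sum_weight_mul_eval hn (hqd k), functional_apply, hleft, hright, integ_apply]
  congr 1
  refine intervalIntegral.integral_congr fun x hx => ?_
  rw [Set.uIcc_of_le (by norm_num)] at hx
  exact (hqf k x hx).symm

/-- The knot `-1` separates the two sets: the roots of `R_n` lie in the open interval, so none of
their translates is a knot. -/
theorem periodicNodes_ne {n : ℕ} (hn : 2 ≤ n) :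
    periodicNodes (nodes n) ≠ periodicNodes (firstNodes n) := by
  intro h
  have h1 : (-1 : ℝ) ∈ periodicNodes (firstNodes n) :=
    ⟨0, -1, by simp [firstNodes], by simp⟩
  rw [← h] at h1
  obtain ⟨k, x, hx, hxk⟩ := h1
  have hx' := (card_nodes_and_mem_Ioo hn).2 x hx
  have h2 : (k : ℝ) < 0 := by linarith [hx'.1]
  have h3 : (-1 : ℝ) < k := by linarith [hx'.2]
  have h4 : k < 0 := by exact_mod_cast h2
  have h5 : -1 < k := by exact_mod_cast h3
  omega

end Spline
end SplineQuad

theorem mainTheorem4 (n : ℕ) (hn : 2 ≤ n) :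
    (SplineQuad.nodes n).card = n ∧
    (∀ x ∈ SplineQuad.nodes n, x ∈ Set.Icc (-1 : ℝ) 1) ∧
    (∀ x ∈ SplineQuad.nodes n,
      (Polynomial.derivative (SplineQuad.polyR n (SplineQuad.delta n))).eval x ≠ 0 ∧
      (SplineQuad.polyS n (SplineQuad.delta n)).eval x ≠ 0) ∧
    SplineQuad.IsExactC1 (2 * n + 1) (SplineQuad.nodes n) (SplineQuad.weight n) ∧
    SplineQuad.periodicNodes (SplineQuad.nodes n) ≠
      SplineQuad.periodicNodes (SplineQuad.firstNodes n) ∧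
    (∃ x : ℝ, (SplineQuad.polyR n (-SplineQuad.delta n)).IsRoot x ∧
      x ∉ Set.Icc (-1 : ℝ) 1) :=
  ⟨(SplineQuad.card_nodes_and_mem_Ioo hn).1,
    fun x hx => Set.Ioo_subset_Icc_self ((SplineQuad.card_nodes_and_mem_Ioo hn).2 x hx),
    fun _ hx => ⟨SplineQuad.eval_derivative_polyR_ne_zero hn hx,
      SplineQuad.eval_polyS_ne_zero hn hx⟩,
    SplineQuad.isExactC1_nodes hn, SplineQuad.periodicNodes_ne hn,
    SplineQuad.exists_root_polyR_neg hn⟩
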